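/- Conventions. Let $X$ be a metric space. A map $f:X\to X$ is a $(K,C)$ quasi-isometry ($K\ge 1$, $C\ge 0$) if $\frac1K d(x,y)-C\le d(f(x),f(y))\le K d(x,y)+C$ for all $x,y$ and every point of $X$ is within distance $C$ of $f(X)$. $QI(X)$ is the group, under composition, of self quasi-isometries of $X$ modulo finite sup-distance. A subgroup of $QI(X)$ is uniform if for some $(K,C)$ each of its elements is represented by a $(K,C)$ quasi-isometry. $X$ is QI-tame if for all $(K,C)$ there is $R_{K,C}$ such that every $(K,C)$ quasi-isometry at finite sup-distance from the identity is at sup-distance at most $R_{K,C}$ from it. A net of $(K,C)$ quasi-isometries $f_i$ (with $K,C$ fixed) coarsely converges to a quasi-isometry $f$ if for some $R$ one has $\limsup_i d(f_i(x),f(x))<R$ for all $x$; then $[f]$ is called a coarse limit of the $[f_i]$. For a uniform subgroup $G$ let $\bar G$ be the set of all coarse limits of nets in $G$, with the following topology of coarse convergence: $U\subset\bar G$ is open if for all $(K,C)$, every $(K,C)$ quasi-isometry $g$ with $[g]\in U$ and every $s>0$ there is a finite set $F\subset X$ such that $[h]\in U$ for every $(K,C)$ quasi-isometry $h$ with $[h]\in\bar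 G$ and $d(h(x),g(x))<s$ for all $x\in F$. The group $G$ carries the subspace topology. Proposition. Let $H$ be a locally compact topological group and let $\Gamma\subset H$ be a discrete subgroup with $H/\Gamma$ compact. Assume that $\Gamma$ is finitely generated and that, with the word metric of a finite generating set, it is QI-tame. Consider pairs $(E,p)$ where $E\subset H$ is an open neighbourhood of the identity with compact closure and $H=\bigcup_{\gamma\in\Gamma}\gamma E$, and where $p:H\to\Gamma$ satisfies $h\in p(h)E$ for all $h\in H$; for such a pair put $q_h(\gamma)=p(h\gamma)$ for $h\in H$, $\gamma\in\Gamma$. Such pairs exist, even with $p(\gamma)=\gamma$ for all $\gamma\in\Gamma$. For every such pair each $q_h:\Gamma\to\Gamma$ is a quasi-isometry, the class $[q_h]\in QI(\Gamma)$ does not depend on the pair, and the map $\Phi:H\to QI(\Gamma)$, $\Phi(h)=[q_h]$, is a group homomorphism onto a uniform subgroup $\Phi(H)$ of $QI(\Gamma)$. The kernel of $\Phi$ is compact. With the topology of coarse convergence on $\Phi(H)$, the map $\Phi:H\to\Phi(H)$ is continuous, and $\Phi(H)$ is a locally compact Hausdorff topological group which is compactly generated, that is, generated by a compact subset. -/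

import Mathlib

open scoped Pointwise

universe u

/-! ## Quasi-isometries and the quasi-isometry group -/

section QuasiIsometry

variable {X : Type u} [PseudoMetricSpace X]

/-- `f : X → X` is a `(K, C)` quasi-isometry. -/
structure IsQI (K C : ℝ) (f : X → X) : Prop where
  one_le : 1 ≤ K
  nonneg : 0 ≤ C
  lower : ∀ x y, K⁻¹ * dist x y - C ≤ dist (f x) (f y)
  upper : ∀ x y, dist (f x) (f y) ≤ K * dist x y + C
  dense : ∀ y, ∃ x, dist (f x) y ≤ C

/-- `f` and `g` are at finite sup-distance. -/
def CoarselyClose (f g : X → X) : Prop :=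
  ∃ B : ℝ, ∀ x, dist (f x) (g x) ≤ B

theorem IsQI.id : IsQI 1 0 (fun x : X => x) where
  one_le := le_rfl
  nonneg := le_rfl
  lower := fun x y => by simp
  upper := fun x y => by simp
  dense := fun y => ⟨y, by simp⟩

theorem IsQI.comp {K C K' C' : ℝ} {f g : X → X} (hf : IsQI K C f) (hg : IsQI K' C' g) :
    IsQI (K * K') (K * C' + 2 * C) (fun x => f (g x)) where
  one_le := one_le_mul_of_one_le_of_one_le hf.one_le hg.one_le
  nonneg := by
    have := hf.one_le; have := hf.nonneg; have := hg.nonneg; positivity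
  lower := fun x y => by
    have h1 := hf.one_le
    have hC := hf.nonneg
    have hC' := hg.nonneg
    have hK : 0 < K := by linarith
    have hi : K⁻¹ ≤ 1 := inv_le_one_of_one_le₀ h1
    have hi0 : 0 ≤ K⁻¹ := by positivity
    have h2 := hf.lower (g x) (g y)
    have h3 := mul_le_mul_of_nonneg_left (hg.lower x y) hi0
    have h4 : K⁻¹ * C' ≤ K * C' := mul_le_mul_of_nonneg_right (hi.trans h1) hC'
    have h5 : (K * K')⁻¹ * dist x y = K⁻¹ * (K'⁻¹ * dist x y) := by rw [mul_inv]; ring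
    rw [h5]
    rw [mul_sub] at h3
    linarith
  upper := fun x y => by
    have hK : 0 ≤ K := by linarith [hf.one_le]
    have h2 := hf.upper (g x) (g y)
    have h3 := mul_le_mul_of_nonneg_left (hg.upper x y) hK
    have hC := hf.nonneg
    rw [mul_add] at h3
    rw [mul_assoc]
    linarith
  dense := fun y => by
    obtain ⟨x, hx⟩ := hf.dense y
    obtain ⟨z, hz⟩ := hg.dense x
    refine ⟨z, ?_⟩
    have hK : 0 ≤ K := by linarith [hf.one_le]
    have h1 := hf.upper (g z) x
    have h2 := mul_le_mul_of_nonneg_left hz hK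
    have h3 := dist_triangle (f (g z)) (f x) y
    linarith

theorem IsQI.exists_coarse_inverse {K C : ℝ} {f : X → X} (hf : IsQI K C f) :
    ∃ g : X → X, IsQI K (3 * K * C) g ∧ CoarselyClose (fun x => g (f x)) (fun x => x) := by
  choose g hg using hf.dense
  have h1 := hf.one_le
  have hC := hf.nonneg
  have hK : 0 < K := by linarith
  have hCK : C ≤ K * C := le_mul_of_one_le_left hC h1
  have key : ∀ (a b : ℝ) (x y : X), dist (f x) (f y) ≤ a + b →
      dist x y ≤ K * (a + b + C) := by
    intro a b x y h
    have h2 := hf.lower x y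
    have h3 : K⁻¹ * dist x y ≤ a + b + C := by linarith
    rwa [inv_mul_le_iff₀ hK] at h3
  have hgf : ∀ x, dist (g (f x)) x ≤ 3 * K * C := by
    intro x
    have := key 0 C (g (f x)) x (by simpa using hg (f x))
    nlinarith [mul_nonneg hK.le hC]
  refine ⟨g, ⟨h1, by positivity, ?_, ?_, fun x => ⟨f x, hgf x⟩⟩, 3 * K * C, hgf⟩
  · intro y z
    have h2 := hf.upper (g y) (g z)
    have h3 := dist_triangle4 y (f (g y)) (f (g z)) z
    have h4 := hg y
    have h5 := hg z
    rw [dist_comm] at h4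
    have h6 : dist y z ≤ K * (dist (g y) (g z) + 3 * C) := by nlinarith
    have h7 : K⁻¹ * dist y z ≤ dist (g y) (g z) + 3 * C := by
      rwa [inv_mul_le_iff₀ hK]
    linarith
  · intro y z
    have h3 := dist_triangle4 (f (g y)) y z (f (g z))
    have h4 := hg y
    have h5 := hg z
    rw [dist_comm] at h5
    have := key (dist y z) (2 * C) (g y) (g z) (by linarith)
    linarith

variable (X) in
/-- The self quasi-isometries of `X`, with arbitrary constants. -/
def SelfQI : Type u := {f : X → X // ∃ K C : ℝ, IsQI K C f}

/-- Two self quasi-isometries are equivalent if they are at finite sup-distance. -/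
instance SelfQI.setoid : Setoid (SelfQI X) where
  r f g := CoarselyClose f.1 g.1
  iseqv :=
    { refl := fun f => ⟨0, fun x => by simp⟩
      symm := fun ⟨B, hB⟩ => ⟨B, fun x => by rw [dist_comm]; exact hB x⟩
      trans := fun ⟨B, hB⟩ ⟨B', hB'⟩ => ⟨B + B', fun x =>
        (dist_triangle _ _ _).trans (add_le_add (hB x) (hB' x))⟩ }

variable (X) in
/-- The quasi-isometry group `QI(X)`. -/
def QI : Type u := Quotient (SelfQI.setoid (X := X))

/-- The class in `QI(X)` of a quasi-isometry. -/
def QI.mk (f : X → X) (hf : ∃ K C : ℝ, IsQI K C f) : QI X :=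
  Quotient.mk SelfQI.setoid ⟨f, hf⟩

/-- Composition of self quasi-isometries. -/
def SelfQI.comp (f g : SelfQI X) : SelfQI X :=
  ⟨fun x => f.1 (g.1 x), by
    obtain ⟨f, K, C, hf⟩ := f
    obtain ⟨g, K', C', hg⟩ := g
    exact ⟨_, _, hf.comp hg⟩⟩

theorem SelfQI.comp_congr (f g f' g' : SelfQI X) (hf : f ≈ f') (hg : g ≈ g') :
    f.comp g ≈ f'.comp g' := by
  obtain ⟨B, hB⟩ := hf
  obtain ⟨B', hB'⟩ := hg
  obtain ⟨K, C, hK⟩ := f.2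
  refine ⟨K * B' + C + B, fun x => ?_⟩
  have h1 := hK.upper (g.1 x) (g'.1 x)
  have h2 := mul_le_mul_of_nonneg_left (hB' x) (by linarith [hK.one_le] : 0 ≤ K)
  have h3 := hB (g'.1 x)
  have h4 := dist_triangle (f.1 (g.1 x)) (f.1 (g'.1 x)) (f'.1 (g'.1 x))
  change dist (f.1 (g.1 x)) (f'.1 (g'.1 x)) ≤ _
  linarith

/-- The product of `QI(X)` is induced by composition: `[f] * [g] = [f ∘ g]`. -/
instance QI.instMul : Mul (QI X) :=
  ⟨Quotient.map₂ SelfQI.comp fun f f' hf g g' hg => SelfQI.comp_congr f g f' g' hf hg⟩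

/-- The unit of `QI(X)` is the class of the identity. -/
instance QI.instOne : One (QI X) := ⟨QI.mk (fun x => x) ⟨1, 0, IsQI.id⟩⟩

theorem QI.exists_left_inv (a : QI X) : ∃ b : QI X, b * a = 1 := by
  induction a using Quotient.inductionOn with
  | h f =>
    obtain ⟨f, K, C, hf⟩ := f
    obtain ⟨g, hg, hgf⟩ := hf.exists_coarse_inverse
    exact ⟨QI.mk g ⟨_, _, hg⟩, Quotient.sound hgf⟩

noncomputable instance QI.instGroup : Group (QI X) where
  mul_assoc a b c := by
    induction a using Quotient.inductionOn
    induction b using Quotient.inductionOn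
    induction c using Quotient.inductionOn
    rfl
  one_mul a := by
    induction a using Quotient.inductionOn
    rfl
  mul_one a := by
    induction a using Quotient.inductionOn
    rfl
  inv a := Classical.choose a.exists_left_inv
  inv_mul_cancel a := Classical.choose_spec a.exists_left_inv

/-- `f` is a `(K, C)` quasi-isometry which represents the class `a`. -/
def Represents (K C : ℝ) (f : X → X) (a : QI X) : Prop :=
  ∃ hf : IsQI K C f, QI.mk f ⟨K, C, hf⟩ = a

/-- A subgroup of `QI(X)` is uniform if all its elements have `(K, C)` quasi-isometry
representatives with the same constants. -/
def IsUniformSubgroup (G : Subgroup (QI X)) : Prop :=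
  ∃ K C : ℝ, ∀ a ∈ G, ∃ f : X → X, Represents K C f a

variable (X) in
/-- `X` is QI-tame: a `(K, C)` quasi-isometry at finite distance from the identity is at
distance at most `R`, where `R` depends on `K` and `C` only. -/
def QITame : Prop :=
  ∀ K C : ℝ, ∃ R : ℝ, ∀ f : X → X, IsQI K C f → CoarselyClose f (fun x => x) →
    ∀ x, dist (f x) x ≤ R

/-! ## Coarse convergence and the topology of coarse convergence -/

/-- A net `F` of self-maps of `X` (indexed along a filter) coarsely converges to `f`:
for some `R`, one has `limsup d(F i x, f x) < R` for all `x`. Since `R` is existentially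
quantified, the condition on the limsup is the same as `d(F i x, f x) < R` eventually. -/
def CoarselyConverges {ι : Type u} (l : Filter ι) (F : ι → X → X) (f : X → X) : Prop :=
  ∃ R : ℝ, ∀ x, ∀ᶠ i in l, dist (F i x) (f x) < R

/-- The set of all coarse limits of nets of elements of `A`. As always in coarse convergence,
the representatives of the members of the net are `(K, C)` quasi-isometries for fixed
`K` and `C`. -/
def coarseClosure (A : Set (QI X)) : Set (QI X) :=
  {a | ∃ (ι : Type u) (l : Filter ι) (_ : l.NeBot) (K C : ℝ) (F : ι → X → X) (f : X → X),
    (∀ i, ∃ b ∈ A, Represents K C (F i) b) ∧ (∃ K' C' : ℝ, Represents K' C' f a) ∧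
      CoarselyConverges l F f}

theorem QI.exists_represents (a : QI X) : ∃ (K C : ℝ) (f : X → X), Represents K C f a := by
  induction a using Quotient.inductionOn with
  | h f =>
    obtain ⟨f, K, C, hf⟩ := f
    exact ⟨K, C, f, hf, rfl⟩

theorem subset_coarseClosure (A : Set (QI X)) : A ⊆ coarseClosure A := by
  intro a ha
  obtain ⟨K, C, f, hf⟩ := a.exists_represents
  exact ⟨PUnit, ⊤, inferInstance, K, C, fun _ => f, f, fun _ => ⟨a, ha, hf⟩, ⟨K, C, hf⟩, 1,
    fun x => by simp⟩

/-- The topology of coarse convergence on a set `A` of classes (used for `A` the set of coarse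
limits of a uniform subgroup): `U` is open if for every `(K, C)` quasi-isometry `g` with
`[g] ∈ U` and every `s > 0` there is a finite set `F` such that `[h] ∈ U` for all
`(K, C)` quasi-isometries `h` with `[h] ∈ A` and `d(h x, g x) < s` for all `x ∈ F`. -/
@[reducible] def coarseTopology (A : Set (QI X)) : TopologicalSpace A where
  IsOpen U := ∀ (K C : ℝ), ∀ a ∈ U, ∀ g : X → X, Represents K C g a → ∀ s : ℝ, 0 < s →
    ∃ F : Finset X, ∀ (b : A) (h : X → X), Represents K C h b →
      (∀ x ∈ F, dist (h x) (g x) < s) → b ∈ U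
  isOpen_univ := fun _ _ _ _ _ _ _ _ => ⟨∅, fun _ _ _ _ => trivial⟩
  isOpen_inter := by
    classical
    intro U V hU hV K C a ha g hg s hs
    obtain ⟨F, hF⟩ := hU K C a ha.1 g hg s hs
    obtain ⟨F', hF'⟩ := hV K C a ha.2 g hg s hs
    exact ⟨F ∪ F', fun b h hb hd =>
      ⟨hF b h hb fun x hx => hd x (Finset.mem_union_left _ hx),
        hF' b h hb fun x hx => hd x (Finset.mem_union_right _ hx)⟩⟩
  isOpen_sUnion := by
    intro 𝒰 h𝒰 K C a ⟨U, hU, ha⟩ g hg s hs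
    obtain ⟨F, hF⟩ := h𝒰 U hU K C a ha g hg s hs
    exact ⟨F, fun b h hb hd => ⟨U, hU, hF b h hb hd⟩⟩

/-- The topology on a subgroup `G` of `QI(X)` as a subspace of the space of all coarse limits of
`G` with the topology of coarse convergence. -/
@[reducible] def whyteTopology (G : Subgroup (QI X)) : TopologicalSpace G :=
  TopologicalSpace.induced (Set.inclusion (subset_coarseClosure (G : Set (QI X))))
    (coarseTopology (coarseClosure (G : Set (QI X))))

end QuasiIsometry

/-! ## Word metrics -/

section WordMetric

variable {G : Type u} [Group G]

/-- The word length of `g`: the least length of a word in `S ∪ S⁻¹` with value `g`. -/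
noncomputable def wordLength (S : Set G) (g : G) : ℕ :=
  sInf {n | ∃ l : List G, l.length = n ∧ (∀ x ∈ l, x ∈ S ∨ x⁻¹ ∈ S) ∧ l.prod = g}

/-- The group `G`, regarded as a metric space with the word metric of a generating set `S`. -/
def WordSpace (S : Set G) (_hS : Subgroup.closure S = ⊤) : Type u := G

theorem wordLength_le {S : Set G} (l : List G) (hl : ∀ x ∈ l, x ∈ S ∨ x⁻¹ ∈ S) :
    wordLength S l.prod ≤ l.length :=
  Nat.sInf_le ⟨l, rfl, hl, rfl⟩

theorem exists_word {S : Set G} (hS : Subgroup.closure S = ⊤) (g : G) :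
    ∃ l : List G, l.length = wordLength S g ∧ (∀ x ∈ l, x ∈ S ∨ x⁻¹ ∈ S) ∧ l.prod = g := by
  have hmem : g ∈ Submonoid.closure (S ∪ S⁻¹) := by
    rw [← Subgroup.closure_toSubmonoid, hS]
    trivial
  obtain ⟨l, hl, hg⟩ := Submonoid.exists_list_of_mem_closure hmem
  exact Nat.sInf_mem (s := {n | ∃ l : List G, l.length = n ∧ (∀ x ∈ l, x ∈ S ∨ x⁻¹ ∈ S) ∧
    l.prod = g}) ⟨_, l, rfl, hl, hg⟩

theorem wordLength_one (S : Set G) : wordLength S 1 = 0 := by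
  have := wordLength_le (S := S) [] (by simp)
  simpa using this

theorem wordLength_inv_le {S : Set G} (hS : Subgroup.closure S = ⊤) (g : G) :
    wordLength S g⁻¹ ≤ wordLength S g := by
  obtain ⟨l, hlen, hl, rfl⟩ := exists_word hS g
  rw [List.prod_inv_reverse, ← hlen]
  refine (wordLength_le _ ?_).trans (by simp)
  intro x hx
  simp only [List.mem_reverse, List.mem_map] at hx
  obtain ⟨y, hy, rfl⟩ := hx
  simpa [or_comm] using hl y hy

theorem wordLength_mul_le {S : Set G} (hS : Subgroup.closure S = ⊤) (g h : G) :
    wordLength S (g * h) ≤ wordLength S g + wordLength S h := by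
  obtain ⟨l, hlen, hl, hlg⟩ := exists_word hS g
  obtain ⟨l', hlen', hl', hlh⟩ := exists_word hS h
  rw [← hlen, ← hlen', ← List.length_append, ← hlg, ← hlh, ← List.prod_append]
  refine wordLength_le _ fun x hx => ?_
  rcases List.mem_append.1 hx with hx | hx
  exacts [hl x hx, hl' x hx]

/-- The word metric `d(x, y) = |x⁻¹ y|`. -/
noncomputable instance WordSpace.instMetricSpace (S : Set G) (hS : Subgroup.closure S = ⊤) :
    MetricSpace (WordSpace S hS) where
  dist := fun (x y : G) => (wordLength S (x⁻¹ * y) : ℝ)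
  dist_self := fun (x : G) => by
    rw [inv_mul_cancel, wordLength_one, Nat.cast_zero]
  dist_comm := fun (x y : G) => by
    have h : ∀ a b : G, wordLength S (a⁻¹ * b) ≤ wordLength S (b⁻¹ * a) := fun a b => by
      simpa using wordLength_inv_le hS (b⁻¹ * a)
    exact congrArg (Nat.cast : ℕ → ℝ) (le_antisymm (h x y) (h y x))
  dist_triangle := fun (x y z : G) => by
    have h := wordLength_mul_le hS (x⁻¹ * y) (y⁻¹ * z)
    rw [show x⁻¹ * y * (y⁻¹ * z) = x⁻¹ * z by group] at h
    change ((wordLength S (x⁻¹ * z) : ℕ) : ℝ) ≤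
      ((wordLength S (x⁻¹ * y) : ℕ) : ℝ) + ((wordLength S (y⁻¹ * z) : ℕ) : ℝ)
    exact_mod_cast h
  eq_of_dist_eq_zero := fun {x y : G} h => by
    have h0 : wordLength S (x⁻¹ * y) = 0 := Nat.cast_eq_zero.1 h
    obtain ⟨l, hlen, -, hl⟩ := exists_word hS (x⁻¹ * y)
    rw [h0, List.length_eq_zero_iff] at hlen
    rw [hlen, List.prod_nil] at hl
    exact (inv_mul_eq_one (G := G)).1 hl.symm

end WordMetric

/-! ## The maps `q_h` -/

/-- The choices in the construction of the maps `q_h` for a subgroup `Γ` of `H`: a relatively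
compact open neighbourhood `E` of the identity with `⋃ γ E = H`, and a map `p : H → Γ` with
`h ∈ p(h) E` for all `h`. -/
structure FurmanChoice {H : Type u} [Group H] [TopologicalSpace H] (Γ : Subgroup H) where
  E : Set H
  isOpen_E : IsOpen E
  one_mem_E : (1 : H) ∈ E
  isCompact_closure_E : IsCompact (closure E)
  iUnion_smul_E : ⋃ γ : Γ, (γ : H) • E = Set.univ
  p : H → Γ
  mem_smul_E : ∀ h : H, h ∈ (p h : H) • E

/-- The map `q_h : Γ → Γ`, `q_h(γ) = p(h γ)`. -/
def FurmanChoice.q {H : Type u} [Group H] [TopologicalSpace H] {Γ : Subgroup H}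
    (D : FurmanChoice Γ) (h : H) : Γ → Γ :=
  fun γ => D.p (h * (γ : H))

/-! Writing `h γ = p(h γ) e` with `e` in the compact set `closure E`, every comparison between
values of the maps `q` becomes the word length of an element of `Γ` lying in a fixed compact product
of copies of `closure E`, its inverse and finite sets. Discreteness leaves finitely many such
elements, so all bounds are uniform in `h`: the `q_h` form a coarse action with common constants. It
is proper because balls in `Γ` are finite, and coarsely continuous because `E` is open
(`exists_isCoarseAction`).

The rest holds for any such action on a nonempty QI-tame space. Tameness makes representatives of
`[q_h]` with given constants uniformly close to `q_h` (`exists_dist_le`). So if representatives of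
`[q_{k_i}]` converge coarsely, properness traps the `k_i` in a compact set, and the limit is close
to `q_{k₀}` for a cluster point `k₀` (`exists_mapClusterPt`). Hence `Φ(H)` contains all its coarse
limits and carries the quotient topology from `H` (`isQuotientMap_rangeRestrict`). Since the kernel
is closed, the topological properties descend from `H`. -/

/-! ## Quotient maps of groups -/

section QuotientMap

variable {A B : Type*} [Group A] [TopologicalSpace A] [IsTopologicalGroup A] [Group B]
  [TopologicalSpace B]

/-- A quotient homomorphism is open, so `f × f` is again a quotient map and multiplication descends.
-/
theorem MonoidHom.isTopologicalGroup_of_isQuotientMap {f : A →* B}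
    (hf : Topology.IsQuotientMap f) : IsTopologicalGroup B where
  continuous_mul := by
    have ho : IsOpenQuotientMap f := MonoidHom.isOpenQuotientMap_of_isQuotientMap hf
    rw [← (ho.prodMap ho).continuous_comp_iff]
    have h : (fun p : B × B => p.1 * p.2) ∘ Prod.map f f = fun p : A × A => f (p.1 * p.2) := by
      ext p
      simp
    rw [h]
    exact hf.continuous.comp continuous_mul
  continuous_inv := by
    rw [hf.continuous_iff]
    have h : (fun b : B => b⁻¹) ∘ f = fun a => f a⁻¹ := by
      ext a
      simp
    rw [h]
    exact hf.continuous.comp continuous_inv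

theorem MonoidHom.t2Space_of_isQuotientMap {f : A →* B} (hf : Topology.IsQuotientMap f)
    (hker : IsClosed (f.ker : Set A)) : T2Space B := by
  have := MonoidHom.isTopologicalGroup_of_isQuotientMap hf
  have h1 : IsClosed ({1} : Set B) := by
    rw [← hf.isClosed_preimage]
    exact hker
  have := IsTopologicalGroup.t1Space B h1
  infer_instance

end QuotientMap

/-! ## Quasi-isometry classes -/

section Classes

variable {X : Type u} [PseudoMetricSpace X]

theorem CoarselyClose.symm {f g : X → X} (h : CoarselyClose f g) : CoarselyClose g f :=
  h.imp fun _ hB x => dist_comm (f x) (g x) ▸ hB x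

theorem QI.mk_eq_mk {f g : X → X} {hf : ∃ K C : ℝ, IsQI K C f} {hg : ∃ K C : ℝ, IsQI K C g} :
    QI.mk f hf = QI.mk g hg ↔ CoarselyClose f g :=
  Quotient.eq (r := SelfQI.setoid (X := X))

theorem Represents.mk {K C : ℝ} {f g : X → X} {hg : ∃ K C : ℝ, IsQI K C g} (hf : IsQI K C f)
    (h : CoarselyClose f g) : Represents K C f (QI.mk g hg) :=
  ⟨hf, QI.mk_eq_mk.2 h⟩

theorem Represents.coarselyClose {K C : ℝ} {f g : X → X} {hg : ∃ K C : ℝ, IsQI K C g}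
    (h : Represents K C f (QI.mk g hg)) : CoarselyClose f g := by
  obtain ⟨_, h⟩ := h
  exact QI.mk_eq_mk.1 h

end Classes

/-! ## Coarse actions -/

/-- A proper, coarsely continuous coarse action of `H` on `X` by `(K, C)` quasi-isometries. -/
structure IsCoarseAction {H : Type*} [Group H] [TopologicalSpace H] {X : Type u}
    [PseudoMetricSpace X] (K C : ℝ) (q : H → X → X) : Prop where
  isQI : ∀ h, IsQI K C (q h)
  dist_comp_le : ∀ g h x, dist (q g (q h x)) (q (g * h) x) ≤ C
  dist_one_le : ∀ x, dist (q 1 x) x ≤ C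
  eventually_dist_le : ∀ h x, ∀ᶠ k in nhds h, dist (q k x) (q h x) ≤ C
  exists_isCompact : ∀ x y r, ∃ Q : Set H, IsCompact Q ∧ ∀ h, dist (q h x) y ≤ r → h ∈ Q

namespace IsCoarseAction

variable {H : Type*} [Group H] [TopologicalSpace H] {X : Type u} [PseudoMetricSpace X]
  {K C : ℝ} {q : H → X → X}

/-- The homomorphism to `QI(X)` defined by a coarse action. -/
def toQI (hq : IsCoarseAction K C q) : H →* QI X where
  toFun h := QI.mk (q h) ⟨K, C, hq.isQI h⟩
  map_one' := QI.mk_eq_mk.2 ⟨C, hq.dist_one_le⟩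
  map_mul' g h := (QI.mk_eq_mk.2 ⟨C, hq.dist_comp_le g h⟩).symm

theorem represents (hq : IsCoarseAction K C q) (h : H) : Represents K C (q h) (hq.toQI h) :=
  ⟨hq.isQI h, rfl⟩

theorem coarselyClose (hq : IsCoarseAction K C q) {K' C' : ℝ} {f : X → X} {h : H}
    (hf : Represents K' C' f (hq.toQI h)) : CoarselyClose f (q h) :=
  Represents.coarselyClose hf

theorem toQI_eq (hq : IsCoarseAction K C q) {K' C' : ℝ} {f : X → X} {a : QI X} {h : H}
    (hf : Represents K' C' f a) (hc : CoarselyClose f (q h)) : hq.toQI h = a := by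
  obtain ⟨_, rfl⟩ := hf
  exact QI.mk_eq_mk.2 hc.symm

theorem mem_ker (hq : IsCoarseAction K C q) {h : H} :
    h ∈ hq.toQI.ker ↔ CoarselyClose (q h) (fun x => x) :=
  QI.mk_eq_mk

theorem isUniformSubgroup_range (hq : IsCoarseAction K C q) :
    IsUniformSubgroup hq.toQI.range := by
  refine ⟨K, C, ?_⟩
  rintro _ ⟨h, rfl⟩
  exact ⟨q h, hq.represents h⟩

theorem dist_inv_le (hq : IsCoarseAction K C q) (h : H) (x : X) :
    dist (q h (q h⁻¹ x)) x ≤ 2 * C := by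
  have h1 := hq.dist_comp_le h h⁻¹ x
  rw [mul_inv_cancel] at h1
  linarith [dist_triangle (q h (q h⁻¹ x)) (q 1 x) x, hq.dist_one_le x]

/-- In a QI-tame space, `(K', C')` representatives of `[q h]` are uniformly close to `q h`. -/
theorem exists_dist_le (hq : IsCoarseAction K C q) (hX : QITame X) (K' C' : ℝ) :
    ∃ M : ℝ, ∀ (h : H) (f : X → X), Represents K' C' f (hq.toQI h) →
      ∀ x, dist (f x) (q h x) ≤ M := by
  obtain ⟨R, hR⟩ := hX (K * K') (K * C' + 2 * C)
  -- `K * R + C` bounds the image under `q h` of the displacement of `q h⁻¹ ∘ f`; `2 * C` is the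
  -- cost of cancelling `q h ∘ q h⁻¹`. The bound `B` below depends on `f` and serves only to make
  -- tameness applicable.
  refine ⟨2 * C + (K * R + C), fun h f hf x => ?_⟩
  obtain ⟨B, hB⟩ := hq.coarselyClose hf
  have hK : 0 ≤ K := by linarith [(hq.isQI h).one_le]
  have hid : CoarselyClose (fun x => q h⁻¹ (f x)) (fun x => x) := by
    refine ⟨K * B + C + 2 * C, fun x => ?_⟩
    have h1 := (hq.isQI h⁻¹).upper (f x) (q h x)
    have h2 := mul_le_mul_of_nonneg_left (hB x) hK
    have h3 := hq.dist_inv_le h⁻¹ x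
    rw [inv_inv] at h3
    linarith [dist_triangle (q h⁻¹ (f x)) (q h⁻¹ (q h x)) x]
  have h1 := hR _ ((hq.isQI h⁻¹).comp hf.1) hid x
  have h2 := (hq.isQI h).upper (q h⁻¹ (f x)) x
  have h3 := mul_le_mul_of_nonneg_left h1 hK
  have h4 := hq.dist_inv_le h (f x)
  rw [dist_comm] at h4
  linarith [dist_triangle (f x) (q h (q h⁻¹ (f x))) (q h x)]

/-- The approximating kernel element depends on the point `x`, but tameness bounds its displacement
by one `R`, so the limit moves all points by at most `C + R`. -/
theorem isClosed_ker (hq : IsCoarseAction K C q) (hX : QITame X) :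
    IsClosed (hq.toQI.ker : Set H) := by
  obtain ⟨R, hR⟩ := hX K C
  refine isClosed_of_closure_subset fun h hh => hq.mem_ker.2 ⟨C + R, fun x => ?_⟩
  obtain ⟨k, hkx, hk⟩ := mem_closure_iff_nhds.1 hh _ (hq.eventually_dist_le h x)
  have h1 : dist (q k x) (q h x) ≤ C := hkx
  rw [dist_comm] at h1
  linarith [dist_triangle (q h x) (q k x) x, hR _ (hq.isQI k) (hq.mem_ker.1 hk) x]

/-- By tameness kernel elements move a base point by at most `R`; properness then confines them to a
compact set. -/
theorem isCompact_ker [Nonempty X] (hq : IsCoarseAction K C q) (hX : QITame X) :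
    IsCompact (hq.toQI.ker : Set H) := by
  obtain ⟨R, hR⟩ := hX K C
  obtain ⟨x⟩ := ‹Nonempty X›
  obtain ⟨Q, hQ, hQx⟩ := hq.exists_isCompact x x R
  exact hQ.of_isClosed_subset (hq.isClosed_ker hX) fun k hk =>
    hQx k (hR _ (hq.isQI k) (hq.mem_ker.1 hk) x)

/-- If representatives of `[q (k i)]` coarsely converge to `f`, then `f` is close to `q k₀` for
some cluster point `k₀` of `k`. -/
theorem exists_mapClusterPt [Nonempty X] (hq : IsCoarseAction K C q) (hX : QITame X) {ι : Type*}
    {l : Filter ι} [l.NeBot] {K' C' R : ℝ} {F : ι → X → X} {f : X → X} {k : ι → H}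
    (hF : ∀ i, Represents K' C' (F i) (hq.toQI (k i)))
    (hf : ∀ x, ∀ᶠ i in l, dist (F i x) (f x) < R) :
    ∃ k₀, MapClusterPt k₀ l k ∧ CoarselyClose f (q k₀) := by
  obtain ⟨M, hM⟩ := hq.exists_dist_le hX K' C'
  have hqf : ∀ x, ∀ᶠ i in l, dist (q (k i) x) (f x) ≤ M + R := fun x => by
    filter_upwards [hf x] with i hi
    have h1 := hM (k i) (F i) (hF i) x
    rw [dist_comm] at h1
    linarith [dist_triangle (q (k i) x) (F i x) (f x)]
  obtain ⟨x₀⟩ := ‹Nonempty X›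
  obtain ⟨Q, hQ, hQx⟩ := hq.exists_isCompact x₀ (f x₀) (M + R)
  obtain ⟨k₀, -, hk₀⟩ := hQ.exists_mapClusterPt_of_frequently
    ((hqf x₀).mono fun i hi => hQx (k i) hi).frequently
  refine ⟨k₀, hk₀, M + R + C, fun x => ?_⟩
  -- The index `i` depends on `x`, the resulting bound does not.
  obtain ⟨i, hi, hi'⟩ :=
    ((hk₀.frequently (hq.eventually_dist_le k₀ x)).and_eventually (hqf x)).exists
  rw [dist_comm] at hi'
  linarith [dist_triangle (f x) (q (k i) x) (q k₀ x)]

theorem coarseClosure_range_subset [Nonempty X] (hq : IsCoarseAction K C q) (hX : QITame X) :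
    coarseClosure (hq.toQI.range : Set (QI X)) ⊆ hq.toQI.range := by
  rintro a ⟨ι, l, hl, K', C', F, f, hF, ⟨K₁, C₁, hf⟩, R, hR⟩
  have hF' : ∀ i, ∃ k, Represents K' C' (F i) (hq.toQI k) := fun i => by
    obtain ⟨_, ⟨k, rfl⟩, hk⟩ := hF i
    exact ⟨k, hk⟩
  choose k hk using hF'
  obtain ⟨k₀, -, hc⟩ := hq.exists_mapClusterPt hX hk hR
  exact ⟨k₀, hq.toQI_eq hf hc⟩

theorem continuous_rangeRestrict (hq : IsCoarseAction K C q) :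
    @Continuous _ _ _ (whyteTopology hq.toQI.range) hq.toQI.rangeRestrict := by
  let _ := coarseTopology (coarseClosure (hq.toQI.range : Set (QI X)))
  rw [continuous_induced_rng, continuous_def]
  intro U hU
  rw [isOpen_iff_mem_nhds]
  intro h hh
  have hC := (hq.isQI 1).nonneg
  -- Nearby `q k` are only within `C` of `q h`, so the scale must exceed `C`; openness is available
  -- at every scale.
  obtain ⟨F, hF⟩ := hU K C _ hh (q h) (hq.represents h) (C + 1) (by linarith)
  have hev : ∀ᶠ k in nhds h, ∀ x ∈ F, dist (q k x) (q h x) ≤ C :=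
    (Filter.eventually_all_finset F).2 fun x _ => hq.eventually_dist_le h x
  filter_upwards [hev] with k hk
  exact hF _ (q k) (hq.represents k) fun x hx => by linarith [hk x hx]

/-- The topology of coarse convergence is the quotient topology. -/
theorem isQuotientMap_rangeRestrict [Nonempty X] (hq : IsCoarseAction K C q) (hX : QITame X) :
    @Topology.IsQuotientMap _ _ _ (whyteTopology hq.toQI.range) hq.toQI.rangeRestrict := by
  let _ := whyteTopology hq.toQI.range
  have hcont := hq.continuous_rangeRestrict
  refine (Topology.isQuotientMap_iff _).2 ⟨Topology.isCoinducing_iff.2 fun U =>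
    ⟨fun hU => ?_, fun hU => hU.preimage hcont⟩, hq.toQI.rangeRestrict_surjective⟩
  -- The set `U` itself, viewed among the coarse limits.
  refine ⟨{b | ∃ hb : b.1 ∈ hq.toQI.range, (⟨b.1, hb⟩ : hq.toQI.range) ∈ U}, ?_, ?_⟩
  · rintro K' C' ⟨a, ha'⟩ ⟨ha, haU⟩ g hg s -
    -- Counterexamples indexed by finite sets under inclusion form a net within `s` of `g`
    -- eventually at each point. Its parameters cluster at a point of the open preimage of `U`, so
    -- some counterexample lies in `U`.
    by_contra! hcon
    choose b f hf hfd hb using hcon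
    have hex : ∀ F, ∃ k, hq.toQI k = (b F).1 := fun F =>
      hq.coarseClosure_range_subset hX (b F).2
    choose k hk using hex
    have hf' : ∀ F, Represents K' C' (f F) (hq.toQI (k F)) := fun F => (hk F).symm ▸ hf F
    have hlim : ∀ x, ∀ᶠ F in Filter.atTop, dist (f F x) (g x) < s := fun x => by
      filter_upwards [Filter.eventually_ge_atTop {x}] with F hF
      exact hfd F x (hF (Finset.mem_singleton_self x))
    obtain ⟨k₀, hk₀, hc⟩ := hq.exists_mapClusterPt hX hf' hlim
    have hk₀a : hq.toQI k₀ = a := hq.toQI_eq hg hc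
    have hk₀U : k₀ ∈ hq.toQI.rangeRestrict ⁻¹' U := by
      subst hk₀a
      exact haU
    obtain ⟨F, hF⟩ := (hk₀.frequently (hU.mem_nhds hk₀U)).exists
    refine hb F ⟨⟨k F, hk F⟩, ?_⟩
    convert (show hq.toQI.rangeRestrict (k F) ∈ U from hF)
    exact Subtype.ext (hk F).symm
  · ext ⟨a, ha⟩
    exact ⟨fun ⟨_, h⟩ => h, fun h => ⟨ha, h⟩⟩

end IsCoarseAction

/-! ## Discrete subgroups and word metrics -/

section Discrete

variable {H : Type u} [Group H] [TopologicalSpace H] [IsTopologicalGroup H]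

/-- For a neighbourhood `V` of 1 with `V⁻¹ V` meeting `Γ` only in 1, each translate of `V` contains
at most one element of `Γ`, and finitely many translates cover `Q`. -/
theorem Subgroup.finite_preimage_of_isCompact (Γ : Subgroup H) [DiscreteTopology Γ] {Q : Set H}
    (hQ : IsCompact Q) : {γ : Γ | (γ : H) ∈ Q}.Finite := by
  obtain ⟨U, hU, hU1⟩ := isOpen_induced_iff.1 (isOpen_discrete ({1} : Set Γ))
  have h1U : (1 : H) ∈ U := by
    have : (1 : Γ) ∈ Subtype.val ⁻¹' U := by rw [hU1]; rfl
    exact this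
  have hcont : Filter.Tendsto (fun p : H × H => p.1⁻¹ * p.2) (nhds (1, 1)) (nhds 1) := by
    have : Continuous fun p : H × H => p.1⁻¹ * p.2 := by fun_prop
    simpa using this.tendsto (1, 1)
  have hmem := hcont (hU.mem_nhds h1U)
  rw [nhds_prod_eq] at hmem
  obtain ⟨V, hV, hVU⟩ := Filter.mem_prod_self_iff.1 hmem
  obtain ⟨t, -, ht⟩ := hQ.elim_nhds_subcover (fun h => h • V) fun h _ => by
    simpa using smul_mem_nhds_smul h hV
  refine (t.finite_toSet.biUnion (t := fun h => {γ : Γ | (γ : H) ∈ h • V})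
    fun h _ => Set.Subsingleton.finite ?_).subset fun γ hγ => ?_
  · intro γ hγ γ' hγ'
    obtain ⟨v, hv, hvγ⟩ := Set.mem_smul_set.1 (show (γ : H) ∈ h • V from hγ)
    obtain ⟨v', hv', hvγ'⟩ := Set.mem_smul_set.1 (show (γ' : H) ∈ h • V from hγ')
    have h1 : v⁻¹ * v' ∈ U := hVU (Set.mk_mem_prod hv hv')
    have h2 : v⁻¹ * v' = ((γ⁻¹ * γ' : Γ) : H) := by
      push_cast
      rw [← hvγ, ← hvγ', smul_eq_mul, smul_eq_mul]
      group
    rw [h2] at h1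
    have h3 : γ⁻¹ * γ' ∈ (Subtype.val ⁻¹' U : Set Γ) := h1
    rw [hU1] at h3
    exact inv_mul_eq_one.1 h3
  · obtain ⟨h, hh, hγh⟩ := Set.mem_iUnion₂.1 (ht hγ)
    exact Set.mem_iUnion₂.2 ⟨h, hh, hγh⟩

theorem Subgroup.exists_wordLength_le_of_isCompact (Γ : Subgroup H) [DiscreteTopology Γ]
    (S : Set Γ) {Q : Set H} (hQ : IsCompact Q) :
    ∃ B : ℕ, ∀ γ : Γ, (γ : H) ∈ Q → wordLength S γ ≤ B := by
  obtain ⟨B, hB⟩ := ((Γ.finite_preimage_of_isCompact hQ).image (wordLength S)).bddAbove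
  exact ⟨B, fun γ hγ => hB ⟨γ, hγ, rfl⟩⟩

end Discrete

section WordMetricLemmas

variable {G : Type u} [Group G]

theorem finite_setOf_wordLength_le {S : Set G} (hfin : S.Finite) (hS : Subgroup.closure S = ⊤)
    (n : ℕ) : {g : G | wordLength S g ≤ n}.Finite := by
  have hT : ∀ m : ℕ, ((S ∪ S⁻¹) ^ m).Finite := fun m => by
    induction m with
    | zero => simp
    | succ m ih => exact pow_succ (S ∪ S⁻¹) m ▸ ih.mul (hfin.union hfin.inv)
  have hprod : ∀ l : List G, (∀ x ∈ l, x ∈ S ∨ x⁻¹ ∈ S) → l.prod ∈ (S ∪ S⁻¹) ^ l.length := by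
    intro l
    induction l with
    | nil => simp
    | cons a l ih =>
      intro h
      rw [List.prod_cons, List.length_cons, pow_succ']
      exact Set.mul_mem_mul (h a (by simp)) (ih fun x hx => h x (by simp [hx]))
  refine ((Set.finite_Iic n).biUnion fun m _ => hT m).subset fun g hg => ?_
  obtain ⟨l, hlen, hl, rfl⟩ := exists_word hS g
  exact Set.mem_iUnion₂.2 ⟨l.length, hlen.trans_le hg, hprod l hl⟩

/-- A map which moves the ends of each edge of the Cayley graph to distance at most `B` is
`B`-Lipschitz. -/
theorem wordLength_map_le {S : Set G} (hS : Subgroup.closure S = ⊤) {B : ℕ} {f : G → G}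
    (hf : ∀ x s, s ∈ S ∨ s⁻¹ ∈ S → wordLength S ((f x)⁻¹ * f (x * s)) ≤ B) (x y : G) :
    wordLength S ((f x)⁻¹ * f y) ≤ B * wordLength S (x⁻¹ * y) := by
  have key : ∀ (l : List G) (x : G), (∀ s ∈ l, s ∈ S ∨ s⁻¹ ∈ S) →
      wordLength S ((f x)⁻¹ * f (x * l.prod)) ≤ B * l.length := by
    intro l
    induction l with
    | nil => simp [wordLength_one]
    | cons s l ih =>
      intro x h
      have h1 := hf x s (h s (by simp))
      have h2 := ih (x * s) fun t ht => h t (by simp [ht])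
      have h3 := wordLength_mul_le hS ((f x)⁻¹ * f (x * s))
        ((f (x * s))⁻¹ * f (x * s * l.prod))
      rw [show (f x)⁻¹ * f (x * s) * ((f (x * s))⁻¹ * f (x * s * l.prod)) =
        (f x)⁻¹ * f (x * s * l.prod) by group] at h3
      rw [List.prod_cons, List.length_cons, ← mul_assoc x, mul_add]
      linarith
  obtain ⟨l, hlen, hl, hxy⟩ := exists_word hS (x⁻¹ * y)
  have := key l x hl
  rwa [hxy, hlen, mul_inv_cancel_left] at this

end WordMetricLemmas

/-! ## The coarse action of `H` on `Γ` -/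

namespace FurmanChoice

variable {H : Type u} [Group H] [TopologicalSpace H] {Γ : Subgroup H}

theorem exists_eq_mul (D : FurmanChoice Γ) (h : H) : ∃ e ∈ closure D.E, h = D.p h * e := by
  obtain ⟨e, he, heq⟩ := Set.mem_smul_set.1 (D.mem_smul_E h)
  exact ⟨e, subset_closure he, heq.symm⟩

variable [IsTopologicalGroup H]

theorem exists_p_coe_eq [LocallyCompactSpace H] [CompactSpace (H ⧸ Γ)] :
    ∃ D : FurmanChoice Γ, ∀ γ : Γ, D.p (γ : H) = γ := by
  classical
  obtain ⟨V, hV, hV1⟩ := exists_compact_mem_nhds (1 : H)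
  have hopen : ∀ h : H, IsOpen ((QuotientGroup.mk : H → H ⧸ Γ) '' (h • interior V)) := fun h =>
    QuotientGroup.isOpenMap_coe _ (isOpen_interior.smul h)
  obtain ⟨t, ht⟩ := isCompact_univ.elim_finite_subcover _ hopen fun x _ => by
    obtain ⟨h, rfl⟩ := QuotientGroup.mk_surjective x
    exact Set.mem_iUnion.2 ⟨h, h, ⟨1, mem_interior_iff_mem_nhds.2 hV1, mul_one h⟩, rfl⟩
  -- Points of `H ⧸ Γ` are cosets `hΓ`, while the cover needed is by translates `γ E`; hence the
  -- inverse.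
  have hQ : IsCompact (insert 1 (⋃ h ∈ t, h • V)⁻¹ : Set H) :=
    (t.isCompact_biUnion fun h _ => hV.smul h).inv.insert 1
  obtain ⟨E, hEo, hQE, hE⟩ := exists_isOpen_superset_and_isCompact_closure hQ
  have hE1 : (1 : H) ∈ E := hQE (Set.mem_insert _ _)
  have hcov : ∀ h : H, ∃ γ : Γ, h ∈ (γ : H) • E := fun h => by
    obtain ⟨g, hg, k, hk, hkh⟩ := Set.mem_iUnion₂.1 (ht (Set.mem_univ (QuotientGroup.mk h⁻¹)))
    have hkΓ : k⁻¹ * h⁻¹ ∈ Γ := QuotientGroup.eq.1 hkh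
    refine ⟨⟨_, Γ.inv_mem hkΓ⟩, Set.mem_smul_set.2 ⟨k⁻¹, hQE (Set.mem_insert_of_mem _ ?_), ?_⟩⟩
    · rw [Set.mem_inv, inv_inv]
      exact Set.mem_iUnion₂.2 ⟨g, hg, Set.smul_set_mono interior_subset hk⟩
    · simp
  choose p hp using hcov
  refine ⟨⟨E, hEo, hE1, hE, ?_, fun h => if hh : h ∈ Γ then ⟨h, hh⟩ else p h, fun h => ?_⟩,
    fun γ => by simp⟩
  · exact Set.eq_univ_of_forall fun h => Set.mem_iUnion.2 ⟨p h, hp h⟩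
  · by_cases hh : h ∈ Γ
    · rw [dif_pos hh]
      exact Set.mem_smul_set.2 ⟨1, hE1, mul_one h⟩
    · rw [dif_neg hh]
      exact hp h

variable {S : Set Γ}

/-- Properness: `h = q_h(x) e x⁻¹`, where `q_h(x)` lies in the finite ball of radius `n` about `y`.
-/
theorem exists_isCompact_q (D : FurmanChoice Γ) (hfin : S.Finite)
    (hS : Subgroup.closure S = ⊤) (x y : Γ) (n : ℕ) :
    ∃ Q : Set H, IsCompact Q ∧ ∀ h, wordLength S ((D.q h x)⁻¹ * y) ≤ n → h ∈ Q := by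
  have hF := (finite_setOf_wordLength_le hfin hS n).image fun g : Γ => (y * g⁻¹ : H)
  refine ⟨_ * closure D.E * {(x : H)⁻¹},
    (hF.isCompact.mul D.isCompact_closure_E).mul isCompact_singleton, fun h hh => ?_⟩
  obtain ⟨e, he, h1⟩ := D.exists_eq_mul (h * x)
  refine Set.mem_mul.2 ⟨_, Set.mul_mem_mul ⟨_, hh, rfl⟩ he, _, rfl, ?_⟩
  refine mul_inv_eq_of_eq_mul ?_
  rw [h1]
  simp [q]

variable [DiscreteTopology Γ]

/-- The difference is `e e'⁻¹`. This makes the class of `q_h` independent of the choices. -/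
theorem exists_wordLength_q_le (D D' : FurmanChoice Γ) (S : Set Γ) :
    ∃ B : ℕ, ∀ (h : H) (x : Γ), wordLength S ((D.q h x)⁻¹ * D'.q h x) ≤ B := by
  obtain ⟨B, hB⟩ := Γ.exists_wordLength_le_of_isCompact S
    (D.isCompact_closure_E.mul D'.isCompact_closure_E.inv)
  refine ⟨B, fun h x => hB _ ?_⟩
  obtain ⟨e, he, h1⟩ := D.exists_eq_mul (h * x)
  obtain ⟨e', he', h2⟩ := D'.exists_eq_mul (h * x)
  refine Set.mem_mul.2 ⟨e, he, e'⁻¹, Set.inv_mem_inv.2 he', ?_⟩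
  have h3 : ((D.p (h * x) : Γ) : H) = h * x * e⁻¹ := eq_mul_inv_of_mul_eq h1.symm
  have h4 : ((D'.p (h * x) : Γ) : H) = h * x * e'⁻¹ := eq_mul_inv_of_mul_eq h2.symm
  simp only [q, Subgroup.coe_mul, Subgroup.coe_inv, h3, h4]
  group

theorem exists_wordLength_q_mul_le (D : FurmanChoice Γ) (hfin : S.Finite) :
    ∃ B : ℕ, ∀ (h : H) (x s : Γ), s ∈ S ∨ s⁻¹ ∈ S →
      wordLength S ((D.q h x)⁻¹ * D.q h (x * s)) ≤ B := by
  have hT : ((Subtype.val : Γ → H) '' (S ∪ S⁻¹)).Finite := (hfin.union hfin.inv).image _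
  obtain ⟨B, hB⟩ := Γ.exists_wordLength_le_of_isCompact S
    ((D.isCompact_closure_E.mul hT.isCompact).mul D.isCompact_closure_E.inv)
  refine ⟨B, fun h x s hs => hB _ ?_⟩
  obtain ⟨e, he, h1⟩ := D.exists_eq_mul (h * x)
  obtain ⟨e', he', h2⟩ := D.exists_eq_mul (h * (x * s : Γ))
  refine Set.mem_mul.2 ⟨e * s, Set.mul_mem_mul he ⟨s, hs, rfl⟩, e'⁻¹, Set.inv_mem_inv.2 he', ?_⟩
  have h3 : ((D.p (h * x) : Γ) : H) = h * x * e⁻¹ := eq_mul_inv_of_mul_eq h1.symm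
  have h4 : ((D.p (h * (x * s : Γ)) : Γ) : H) = h * (x * s : Γ) * e'⁻¹ :=
    eq_mul_inv_of_mul_eq h2.symm
  change _ = (D.p (h * x) : H)⁻¹ * D.p (h * (x * s : Γ))
  rw [h3, h4, Subgroup.coe_mul]
  group

/-- Three applications of `exists_eq_mul` turn the difference into `e' e e₁⁻¹`. -/
theorem exists_wordLength_q_q_le (D : FurmanChoice Γ) (S : Set Γ) :
    ∃ B : ℕ, ∀ (g h : H) (x : Γ), wordLength S ((D.q g (D.q h x))⁻¹ * D.q (g * h) x) ≤ B := by
  have hE := D.isCompact_closure_E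
  obtain ⟨B, hB⟩ := Γ.exists_wordLength_le_of_isCompact S ((hE.mul hE).mul hE.inv)
  refine ⟨B, fun g h x => hB _ ?_⟩
  obtain ⟨e, he, h1⟩ := D.exists_eq_mul (h * x)
  obtain ⟨e', he', h2⟩ := D.exists_eq_mul (g * D.p (h * x))
  obtain ⟨e₁, he₁, h3⟩ := D.exists_eq_mul (g * h * x)
  refine Set.mem_mul.2 ⟨e' * e, Set.mul_mem_mul he' he, e₁⁻¹, Set.inv_mem_inv.2 he₁, ?_⟩
  have h4 : ((D.p (h * x) : Γ) : H) = h * x * e⁻¹ := eq_mul_inv_of_mul_eq h1.symm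
  have h5 := eq_mul_inv_of_mul_eq h2.symm
  have h6 := eq_mul_inv_of_mul_eq h3.symm
  simp only [q, Subgroup.coe_mul, Subgroup.coe_inv, h5, h6]
  rw [h4]
  group

theorem exists_wordLength_q_one_le (D : FurmanChoice Γ) (S : Set Γ) :
    ∃ B : ℕ, ∀ x : Γ, wordLength S ((D.q 1 x)⁻¹ * x) ≤ B := by
  obtain ⟨B, hB⟩ := Γ.exists_wordLength_le_of_isCompact S D.isCompact_closure_E
  refine ⟨B, fun x => hB _ ?_⟩
  obtain ⟨e, he, h1⟩ := D.exists_eq_mul (1 * x)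
  have h2 := eq_mul_inv_of_mul_eq h1.symm
  convert he
  simp only [q, Subgroup.coe_mul, Subgroup.coe_inv, h2]
  group

theorem exists_eventually_wordLength_q_le (D : FurmanChoice Γ) (S : Set Γ) :
    ∃ B : ℕ, ∀ (h : H) (x : Γ), ∀ᶠ k in nhds h,
      wordLength S ((D.q k x)⁻¹ * D.q h x) ≤ B := by
  have hE := D.isCompact_closure_E
  obtain ⟨B, hB⟩ := Γ.exists_wordLength_le_of_isCompact S (hE.mul hE.inv)
  refine ⟨B, fun h x => ?_⟩
  -- For `k` near `h`, `p(h x)` is still an admissible value at `k x`, because `E` is open.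
  have hopen : IsOpen ((fun k : H => k * x) ⁻¹' ((D.p (h * x) : H) • D.E)) :=
    (D.isOpen_E.smul _).preimage (continuous_mul_const _)
  filter_upwards [hopen.mem_nhds (D.mem_smul_E (h * x))] with k hk
  refine hB _ ?_
  obtain ⟨e, he, h1⟩ := D.exists_eq_mul (k * x)
  obtain ⟨e', he', h2⟩ := Set.mem_smul_set.1 (show k * (x : H) ∈ (D.p (h * x) : H) • D.E from hk)
  refine Set.mem_mul.2 ⟨e, he, e'⁻¹, Set.inv_mem_inv.2 (subset_closure he'), ?_⟩
  have h3 : ((D.p (k * x) : Γ) : H) = k * x * e⁻¹ := eq_mul_inv_of_mul_eq h1.symm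
  have h4 : ((D.p (h * x) : Γ) : H) = k * x * e'⁻¹ := eq_mul_inv_of_mul_eq h2
  simp only [q, Subgroup.coe_mul, Subgroup.coe_inv, h3, h4]
  group

theorem exists_isCoarseAction (D : FurmanChoice Γ) (hfin : S.Finite)
    (hS : Subgroup.closure S = ⊤) :
    ∃ K C : ℝ, IsCoarseAction (X := WordSpace S hS) K C D.q := by
  obtain ⟨L, hL⟩ := D.exists_wordLength_q_mul_le hfin
  obtain ⟨B₁, hB₁⟩ := D.exists_wordLength_q_q_le S
  obtain ⟨B₂, hB₂⟩ := D.exists_wordLength_q_one_le S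
  obtain ⟨B₃, hB₃⟩ := D.exists_eventually_wordLength_q_le S
  let X := WordSpace S hS
  have hd : ∀ {x y : Γ} {n : ℕ}, wordLength S (x⁻¹ * y) ≤ n → dist (α := X) x y ≤ n :=
    fun h => Nat.cast_le.2 h
  have hlip : ∀ (h : H) (x y : X), dist (α := X) (D.q h x) (D.q h y) ≤ (L + 1) * dist x y := by
    intro h (x : Γ) (y : Γ)
    have h1 : dist (α := X) (D.q h x) (D.q h y) ≤ ((L * wordLength S (x⁻¹ * y) : ℕ) : ℝ) :=
      hd (wordLength_map_le hS (hL h) x y)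
    have h2 : dist (α := X) x y = (wordLength S (x⁻¹ * y) : ℝ) := rfl
    rw [Nat.cast_mul, ← h2] at h1
    linarith [dist_nonneg (α := X) (x := x) (y := y)]
  have hcomp : ∀ (g h : H) (x : X), dist (α := X) (D.q g (D.q h x)) (D.q (g * h) x) ≤ B₁ :=
    fun g h x => hd (hB₁ g h x)
  have hone : ∀ x : X, dist (α := X) (D.q 1 x) x ≤ B₂ := fun x => hd (hB₂ x)
  have hL0 : (0 : ℝ) ≤ L := Nat.cast_nonneg L
  have hB₁0 : (0 : ℝ) ≤ B₁ := Nat.cast_nonneg B₁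
  have hB₂0 : (0 : ℝ) ≤ B₂ := Nat.cast_nonneg B₂
  have hB₃0 : (0 : ℝ) ≤ B₃ := Nat.cast_nonneg B₃
  have hinv : ∀ (h : H) (x : X), dist (α := X) (D.q h⁻¹ (D.q h x)) x ≤ B₁ + B₂ := by
    intro h x
    have h1 := hcomp h⁻¹ h x
    rw [inv_mul_cancel] at h1
    linarith [dist_triangle (α := X) (D.q h⁻¹ (D.q h x)) (D.q 1 x) x, hone x]
  -- The lower bound is the Lipschitz bound for `q h⁻¹`, losing `B₁ + B₂` at each end; `q h⁻¹ y`
  -- also witnesses coarse surjectivity. `L + 1` ensures a constant at least 1.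
  refine ⟨L + 1, 2 * (B₁ + B₂) + B₃, fun h => ⟨by linarith, by positivity, fun x y => ?_,
    fun x y => ?_, fun y => ⟨D.q h⁻¹ y, ?_⟩⟩, fun g h x => ?_, fun x => ?_, fun h x => ?_,
    fun x y r => ?_⟩
  · have h1 := hlip h⁻¹ (D.q h x) (D.q h y)
    have h2 : dist (α := X) x (D.q h⁻¹ (D.q h x)) ≤ B₁ + B₂ :=
      (dist_comm (α := X) _ _).trans_le (hinv h x)
    have h3 := dist_triangle4 (α := X) x (D.q h⁻¹ (D.q h x)) (D.q h⁻¹ (D.q h y)) y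
    have h4 := hinv h y
    rw [sub_le_iff_le_add, inv_mul_le_iff₀ (by linarith)]
    nlinarith
  · linarith [hlip h x y]
  · have h1 := hinv h⁻¹ y
    rw [inv_inv] at h1
    linarith
  · linarith [hcomp g h x]
  · linarith [hone x]
  · filter_upwards [hB₃ h x] with k hk
    have h1 : dist (α := X) (D.q k x) (D.q h x) ≤ B₃ := hd hk
    linarith
  · obtain ⟨Q, hQ, hQ'⟩ := D.exists_isCompact_q hfin hS x y ⌊r⌋₊
    exact ⟨Q, hQ, fun h hh => hQ' h (Nat.le_floor hh)⟩

end FurmanChoice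

theorem mainTheorem5 {H : Type u} [Group H] [TopologicalSpace H] [IsTopologicalGroup H]
    [LocallyCompactSpace H] (Γ : Subgroup H) [DiscreteTopology Γ] [CompactSpace (H ⧸ Γ)]
    (S : Set Γ) (hfin : S.Finite) (hS : Subgroup.closure S = ⊤)
    (htame : QITame (WordSpace S hS)) :
    -- the construction can be carried out
    (∃ D : FurmanChoice Γ, ∀ γ : Γ, D.p (γ : H) = γ) ∧
    -- all choices give the same homomorphism `Φ h = [q_h]`
    ∃ Φ : H →* QI (WordSpace S hS),
      (∀ (D : FurmanChoice Γ) (h : H), ∃ K C : ℝ,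
        Represents (X := WordSpace S hS) K C (D.q h) (Φ h)) ∧
      IsUniformSubgroup Φ.range ∧
      IsCompact (Φ.ker : Set H) ∧
      (letI : TopologicalSpace Φ.range := whyteTopology Φ.range
       Continuous Φ.rangeRestrict ∧
       IsTopologicalGroup Φ.range ∧ T2Space Φ.range ∧ LocallyCompactSpace Φ.range ∧
       ∃ Q : Set Φ.range, IsCompact Q ∧ Subgroup.closure Q = ⊤) := by
  have hD := FurmanChoice.exists_p_coe_eq (Γ := Γ)
  refine ⟨hD, ?_⟩
  obtain ⟨D, -⟩ := hD
  have : Nonempty (WordSpace S hS) := ⟨(1 : Γ)⟩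
  obtain ⟨K, C, hq⟩ := D.exists_isCoarseAction hfin hS
  have hquot := hq.isQuotientMap_rangeRestrict htame
  have hcont := hq.continuous_rangeRestrict
  refine ⟨hq.toQI, fun D' h => ?_, hq.isUniformSubgroup_range, hq.isCompact_ker htame, hcont, ?_⟩
  · obtain ⟨K', C', hq'⟩ := D'.exists_isCoarseAction hfin hS
    obtain ⟨B, hB⟩ := D'.exists_wordLength_q_le D S
    exact ⟨K', C', Represents.mk (hq'.isQI h) ⟨B, fun x => Nat.cast_le.2 (hB h x)⟩⟩
  let _ : TopologicalSpace hq.toQI.range := whyteTopology hq.toQI.range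
  have hker : IsClosed (hq.toQI.rangeRestrict.ker : Set H) := by
    rw [MonoidHom.ker_rangeRestrict]
    exact hq.isClosed_ker htame
  refine ⟨MonoidHom.isTopologicalGroup_of_isQuotientMap hquot,
    MonoidHom.t2Space_of_isQuotientMap hquot hker,
    (MonoidHom.isOpenQuotientMap_of_isQuotientMap hquot).locallyCompactSpace,
    hq.toQI.rangeRestrict '' (closure D.E ∪ Subtype.val '' S),
    (D.isCompact_closure_E.union (hfin.image _).isCompact).image hcont, ?_⟩
  -- Since `h = p(h) e`, generators of `Γ` together with `closure D.E` generate `H`.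
  have hgen : Subgroup.closure (closure D.E ∪ Subtype.val '' S) = ⊤ := by
    rw [eq_top_iff]
    intro h _
    obtain ⟨e, he, heq⟩ := D.exists_eq_mul h
    have hΓ : Γ ≤ Subgroup.closure (Subtype.val '' S) := by
      have := MonoidHom.map_closure Γ.subtype S
      rw [hS, ← MonoidHom.range_eq_map, Subgroup.range_subtype] at this
      exact this.le
    rw [heq]
    exact mul_mem (Subgroup.closure_mono Set.subset_union_right (hΓ (D.p h).2))
      (Subgroup.subset_closure (Or.inl he))
  rw [← MonoidHom.map_closure, hgen, ← MonoidHom.range_eq_map, MonoidHom.range_eq_top]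
  exact hq.toQI.rangeRestrict_surjective
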